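/- Let $(K,\nu)$ be a rank one discrete valued field, normalized so that $\nu(K^*)=\mathbb Z$, with valuation ring $R_\nu$, residue field $\mathbb F_\nu$ and henselization $K^h$ (the separable closure of $K$ in its completion). Extend $\nu$ to polynomials over $R_\nu$ as the minimum of the valuations of the coefficients. For $f\in R_\nu[x]$ and a monic $\phi\in R_\nu[x]$ of positive degree, write $f=\sum_k a_k\phi^k$ with $\deg a_k<\deg\phi$; the $\phi$-Newton polygon $N_\phi(f)$ is the lower boundary of the convex hull of the points $(k,\nu(a_k))$ with $a_k\ne 0$, and its edges are called its sides. The length $l$ of a side is the length of its projection to the horizontal axis; a side of negative slope $-h/e$, with $h,e$ positive coprime integers, has degree $d=l/e$. Let $f\in R_\nu[x]$ be monic and let $\overline{f}=\prod_{i=1}^r\overline{\phi_i}^{\,n_i}$ ($n_i\ge 1$) be the factorization of its reduction in $\mathbb F_\nu[x]$, where the $\phi_i\in R_\nu[x]$ are monic and the $\overline{\phi_i}$ are irreducible and pairwise distinct. Assume that no $\phi_i$ divides $f$ in $R_\nu[x]$ (that is, the coefficient $a_0$ of the $\phi_i$-expansion of $f$ is nonzero for every $i$). For every $i$ let $S_{i1},\dots,S_{ig_i}$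 be the sides of negative slope of $N_{\phi_i}(f)$ and let $d_{ij}$ be the degree of $S_{ij}$. Then, counted with multiplicity, $f$ has at most $\sum_{i=1}^r\sum_{j=1}^{g_i}d_{ij}$ irreducible factors over $K^h$, and at most that many over $K$. -/

import Mathlib

open Polynomial
open scoped WithZero

namespace NewtonFactor

noncomputable section

/-! ### Newton polygons with respect to a monic polynomial

A normalized discrete valuation `ν` with `ν(K^*) = ℤ` is given multiplicatively, as a surjective
`v : Valuation K ℤᵐ⁰`; so `ν x = -log (v x)` for `x ≠ 0`. Its valuation ring is
`v.valuationSubring`. -/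

section Valued

variable {K : Type*} [Field K] (v : Valuation K ℤᵐ⁰)

/-- The valuation of a polynomial: the minimum of the (additive) valuations of its nonzero
coefficients, and `⊤` for the zero polynomial. -/
def polyVal (a : v.valuationSubring[X]) : WithTop ℤ :=
  a.support.inf fun k => ((-WithZero.log (v (a.coeff k : K)) : ℤ) : WithTop ℤ)

end Valued

/-- The `i`-th coefficient `a_i` of the `φ`-expansion `f = ∑ a_i φ ^ i`, `deg a_i < deg φ`. -/
def expCoeff {R : Type*} [CommRing R] (φ f : R[X]) (i : ℕ) : R[X] :=
  (f /ₘ φ ^ i) %ₘ φ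

theorem degree_expCoeff_lt {R : Type*} [CommRing R] [Nontrivial R] {φ : R[X]} (hφ : φ.Monic)
    (f : R[X]) (i : ℕ) : (expCoeff φ f i).degree < φ.degree :=
  degree_modByMonic_lt _ hφ

/-- The coefficients `expCoeff φ f i` do give the `φ`-expansion of `f`. -/
theorem sum_expCoeff {R : Type*} [CommRing R] [IsDomain R] {φ : R[X]} (hφ : φ.Monic)
    (hd : 0 < φ.natDegree) (f : R[X]) :
    ∑ i ∈ Finset.range (f.natDegree + 1), expCoeff φ f i * φ ^ i = f := by
  have key : ∀ n : ℕ, ∑ i ∈ Finset.range n, expCoeff φ f i * φ ^ i + (f /ₘ φ ^ n) * φ ^ n = f := by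
    intro n
    induction n with
    | zero => simp
    | succ n ih =>
      have hq : f /ₘ φ ^ (n + 1) = (f /ₘ φ ^ n) /ₘ φ := by
        have h1 := modByMonic_add_div f (φ ^ n)
        have h2 := modByMonic_add_div (f /ₘ φ ^ n) φ
        refine (div_modByMonic_unique (f := f) (g := φ ^ (n + 1)) ((f /ₘ φ ^ n) /ₘ φ)
          (f %ₘ φ ^ n + φ ^ n * ((f /ₘ φ ^ n) %ₘ φ)) (hφ.pow _) ⟨?_, ?_⟩).1
        · rw [pow_succ]
          linear_combination h1 + φ ^ n * h2
        · have hlt : (φ ^ n).degree < (φ ^ (n + 1)).degree := by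
            rw [degree_eq_natDegree (hφ.pow n).ne_zero, degree_eq_natDegree (hφ.pow (n + 1)).ne_zero,
              hφ.natDegree_pow, hφ.natDegree_pow]
            exact_mod_cast Nat.mul_lt_mul_of_pos_right (Nat.lt_succ_self n) hd
          refine (degree_add_le _ _).trans_lt (max_lt
            ((degree_modByMonic_lt f (hφ.pow n)).trans hlt) ?_)
          rw [pow_succ, degree_mul, degree_mul]
          refine WithBot.add_lt_add_left ?_ (degree_modByMonic_lt _ hφ)
          exact degree_ne_bot.mpr (hφ.pow n).ne_zero
      rw [Finset.sum_range_succ, hq]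
      have h2 := modByMonic_add_div (f /ₘ φ ^ n) φ
      rw [pow_succ]
      unfold expCoeff at ih ⊢
      linear_combination ih + φ ^ n * h2
  have h0 : f /ₘ φ ^ (f.natDegree + 1) = 0 := by
    rw [divByMonic_eq_zero_iff (hφ.pow _), degree_eq_natDegree (hφ.pow _).ne_zero, hφ.natDegree_pow]
    refine degree_le_natDegree.trans_lt ?_
    have : f.natDegree < (f.natDegree + 1) * φ.natDegree := by nlinarith
    exact_mod_cast this
  simpa [h0] using key (f.natDegree + 1)

/-- For points `(i, u i)`, `i ∈ ℕ` (where `u i = ⊤` means that there is no point over `i`), the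
segment from `(s, u s)` to `(t, u t)` is a side of the lower boundary of their convex hull: no
point lies below the line through its end points, and every point on that line lies on the
segment. -/
def IsSide (u : ℕ → WithTop ℤ) (s t : ℕ) : Prop :=
  s < t ∧ ∃ a b : ℤ, u s = a ∧ u t = b ∧ ∀ (i : ℕ) (c : ℤ), u i = c →
    ((t : ℤ) - i) * a + ((i : ℤ) - s) * b ≤ ((t : ℤ) - s) * c ∧
    (((t : ℤ) - i) * a + ((i : ℤ) - s) * b = ((t : ℤ) - s) * c → s ≤ i ∧ i ≤ t)

/-- The slope of the segment from `(s, u s)` to `(t, u t)`. -/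
def slope (u : ℕ → WithTop ℤ) (s t : ℕ) : ℚ :=
  (((u t).untopD 0 - (u s).untopD 0 : ℤ) : ℚ) / ((t : ℚ) - (s : ℚ))

/-- The degree `l / e` of the segment from `(s, u s)` to `(t, u t)`: its length `l = t - s` divided
by the denominator `e` of its slope in lowest terms. -/
def sideDegree (u : ℕ → WithTop ℤ) (s t : ℕ) : ℕ := (t - s) / (slope u s t).den

/-- The division in `sideDegree` is exact. -/
theorem sideDegree_mul_den (u : ℕ → WithTop ℤ) {s t : ℕ} (h : s < t) :
    sideDegree u s t * (slope u s t).den = t - s := by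
  refine Nat.div_mul_cancel ?_
  have h1 : slope u s t = Rat.divInt ((u t).untopD 0 - (u s).untopD 0) ((t - s : ℕ) : ℤ) := by
    rw [Rat.divInt_eq_div]
    simp [slope, Nat.cast_sub h.le]
  rw [← Int.natCast_dvd_natCast, h1]
  exact Rat.den_dvd _ _

variable {K : Type*} [Field K] (v : Valuation K ℤᵐ⁰)

/-- The points `(i, ν(a_i))` attached to the `φ`-expansion `f = ∑ a_i φ ^ i`. -/
def newtonPoint (φ f : v.valuationSubring[X]) (i : ℕ) : WithTop ℤ :=
  polyVal v (expCoeff φ f i)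

open Classical in
/-- The sides of negative slope of the `φ`-Newton polygon of `f`, each given by the abscissas of its
end points. (If `φ` is monic of positive degree then `a_i = 0` for `i > deg f`.) -/
def negSides (φ f : v.valuationSubring[X]) : Finset (ℕ × ℕ) :=
  (Finset.range (f.natDegree + 1) ×ˢ Finset.range (f.natDegree + 1)).filter fun p =>
    IsSide (newtonPoint v φ f) p.1 p.2 ∧ slope (newtonPoint v φ f) p.1 p.2 < 0

/-- The henselization `K^h` of the rank one valued field `(K, v)`: the separable closure of `K` in
the completion of `(K, v)`, that is, the field of all elements of the completion that are separable
algebraic over `K`. (`WithVal v` is Mathlib's copy of the field `K` with the topology of `v`.) -/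
abbrev Henselization : Type _ := separableClosure (WithVal v) v.Completion

/-- The inclusion of `K` in its henselization. -/
def toHenselization : K →+* Henselization v :=
  (algebraMap (WithVal v) (Henselization v)).comp (WithVal.equiv v).symm.toRingHom

/-- Reduction of polynomials over the valuation ring modulo the maximal ideal. -/
def reduction (f : v.valuationSubring[X]) : (IsLocalRing.ResidueField v.valuationSubring)[X] :=
  f.map (IsLocalRing.residue v.valuationSubring)

end

end NewtonFactor

/-! Only immediacy of the extension matters: `card_factors_le_sum_sideDegree` bounds the number of
irreducible factors over any field with the same value group and residue field, and both `K^h` and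
`K` itself qualify. By Gauss's lemma (`exists_monic_lift_factors`) the factors may be taken monic
over the valuation ring, say `f = ∏ g_j`.

The reduction of each `g_j` is divisible by that of some `φ_i`, while `φ_i` does not divide `g_j`.
So the `φ_i`-polygon of `g_j` starts above the axis and comes down to it: it has a side of some
slope `-lam < 0` (`exists_edge`). The polygon of a product is the Minkowski sum of the polygons, so
for fixed `lam` the edge of `f` has as length the sum of the lengths of the edges of the `g_j`, a
vertex counting as an edge of length `0`. Nonzero lengths are multiples of `e = lam.den`
(`IsEdgeEnd.den_dvd`), hence a side of length `l` receives at most `l / e` of the `g_j`.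

Additivity is proved one end point at a time. A product of two `φ`-expansions is not a
`φ`-expansion, so leading terms are defined by `IsLead` for arbitrary presentations, modulo an ideal
of terms of greater weight. Giving `π` and `φ` the lexicographic weights `(1, 0)` and `(lam, ε)`,
the first component selects the edge of slope `-lam`, and `ε = 1` or `-1` breaks ties in favour of
its left or right end. As `(π, φ)` is prime, leading terms multiply (`IsLead.mul`). -/

namespace NewtonFactor

/-! ### Leading terms with respect to a weight -/

section Lead

variable {A : Type*} [CommRing A] {Γ : Type*} [AddCommMonoid Γ] [LinearOrder Γ]

/-- The ideal of elements all of whose terms `P ^ n * φ ^ k` have weight `n • α + k • γ` greater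
than `δ`. -/
def weightIdeal (α γ : Γ) (P φ : A) (δ : Γ) : Ideal A :=
  Ideal.span {x | ∃ n k : ℕ, δ < n • α + k • γ ∧ x = P ^ n * φ ^ k}

/-- `f` has `P ^ n * φ ^ k`, up to a factor outside of `(P, φ)`, as its only term of smallest
weight. -/
def IsLead (α γ : Γ) (P φ f : A) (k n : ℕ) : Prop :=
  ∃ b g, f = b * (P ^ n * φ ^ k) + g ∧ b ∉ Ideal.span {P, φ} ∧
    g ∈ weightIdeal α γ P φ (n • α + k • γ)

variable {α γ : Γ} {P φ : A}

theorem weightIdeal_anti {δ ε : Γ} (h : δ ≤ ε) :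
    weightIdeal α γ P φ ε ≤ weightIdeal α γ P φ δ :=
  Ideal.span_mono fun _ ⟨n, k, h1, h2⟩ => ⟨n, k, h.trans_lt h1, h2⟩

theorem weight_add {Γ : Type*} [AddCommMonoid Γ] {α γ : Γ} (n k m l : ℕ) :
    (n + m) • α + (k + l) • γ = (n • α + k • γ) + (m • α + l • γ) := by
  rw [add_smul, add_smul, add_add_add_comm]

variable [IsOrderedCancelAddMonoid Γ]

theorem mul_mem_weightIdeal_of_mem {δ : Γ} {g : A} (hg : g ∈ weightIdeal α γ P φ δ) (m l : ℕ) :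
    g * (P ^ m * φ ^ l) ∈ weightIdeal α γ P φ (δ + (m • α + l • γ)) := by
  induction hg using Submodule.span_induction with
  | mem x hx =>
    obtain ⟨n, k, h, rfl⟩ := hx
    refine Ideal.subset_span ⟨n + m, k + l, ?_, by ring⟩
    rw [weight_add]
    gcongr
  | zero => simp
  | add x y _ _ hx hy => rw [add_mul]; exact Ideal.add_mem _ hx hy
  | smul a x _ hx => rw [smul_eq_mul, mul_assoc]; exact Ideal.mul_mem_left _ _ hx

theorem mul_mem_weightIdeal {δ ε : Γ} {f g : A} (hf : f ∈ weightIdeal α γ P φ δ)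
    (hg : g ∈ weightIdeal α γ P φ ε) : f * g ∈ weightIdeal α γ P φ (δ + ε) := by
  induction hg using Submodule.span_induction with
  | mem x hx =>
    obtain ⟨n, k, h, rfl⟩ := hx
    exact weightIdeal_anti (by gcongr) (mul_mem_weightIdeal_of_mem hf n k)
  | zero => simp
  | add x y _ _ hx hy => rw [mul_add]; exact Ideal.add_mem _ hx hy
  | smul a x _ hx => rw [smul_eq_mul, mul_left_comm]; exact Ideal.mul_mem_left _ _ hx

/-- The product of the two leading factors stays outside the prime ideal `(P, φ)`, and all other
products have strictly greater weight. -/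
theorem IsLead.mul [hJ : (Ideal.span {P, φ}).IsPrime] {f g : A} {k n l m : ℕ}
    (hf : IsLead α γ P φ f k n) (hg : IsLead α γ P φ g l m) :
    IsLead α γ P φ (f * g) (k + l) (n + m) := by
  obtain ⟨b, r, rfl, hb, hr⟩ := hf
  obtain ⟨c, s, rfl, hc, hs⟩ := hg
  refine ⟨b * c, c * (r * (P ^ m * φ ^ l)) + b * (s * (P ^ n * φ ^ k)) + r * s, by ring,
    fun h => (hJ.mem_or_mem h).elim hb hc, ?_⟩
  rw [weight_add]
  refine Ideal.add_mem _ (Ideal.add_mem _ ?_ ?_) (mul_mem_weightIdeal hr hs)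
  · exact Ideal.mul_mem_left _ _ (mul_mem_weightIdeal_of_mem hr m l)
  · rw [add_comm (n • α + k • γ)]
    exact Ideal.mul_mem_left _ _ (mul_mem_weightIdeal_of_mem hs n k)

theorem IsLead.prod [hJ : (Ideal.span {P, φ}).IsPrime] {ι : Type*} (T : Finset ι) {g : ι → A}
    {k n : ι → ℕ} (hg : ∀ i ∈ T, IsLead α γ P φ (g i) (k i) (n i)) :
    IsLead α γ P φ (∏ i ∈ T, g i) (∑ i ∈ T, k i) (∑ i ∈ T, n i) := by
  classical
  induction T using Finset.induction_on with
  | empty =>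
    exact ⟨1, 0, by simp, fun h => hJ.ne_top ((Ideal.eq_top_iff_one _).2 h), Ideal.zero_mem _⟩
  | insert i T hi ih =>
    rw [Finset.prod_insert hi, Finset.sum_insert hi, Finset.sum_insert hi]
    exact (hg i (by simp)).mul (ih fun j hj => hg j (by simp [hj]))

end Lead

/-! ### Coefficients of `φ`-expansions -/

section Expansion

variable {R : Type*} [CommRing R] {φ : R[X]}

theorem add_divByMonic' (hφ : φ.Monic) (f g : R[X]) : (f + g) /ₘ φ = f /ₘ φ + g /ₘ φ := by
  nontriviality R
  refine (div_modByMonic_unique _ (f %ₘ φ + g %ₘ φ) hφ ⟨?_, ?_⟩).1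
  · linear_combination modByMonic_add_div f φ + modByMonic_add_div g φ
  · exact (degree_add_le _ _).trans_lt
      (max_lt (degree_modByMonic_lt _ hφ) (degree_modByMonic_lt _ hφ))

theorem C_mul_divByMonic (hφ : φ.Monic) (c : R) (f : R[X]) : (C c * f) /ₘ φ = C c * (f /ₘ φ) := by
  nontriviality R
  refine (div_modByMonic_unique _ (C c * (f %ₘ φ)) hφ ⟨?_, ?_⟩).1
  · linear_combination C c * modByMonic_add_div f φ
  · rw [← smul_eq_C_mul]
    exact (degree_smul_le _ _).trans_lt (degree_modByMonic_lt _ hφ)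

theorem C_mul_modByMonic (c : R) (f : R[X]) : (C c * f) %ₘ φ = C c * (f %ₘ φ) := by
  rw [← smul_eq_C_mul, smul_modByMonic, smul_eq_C_mul]

theorem C_pow_mul_modByMonic (c : R) (n : ℕ) (f : R[X]) :
    (C c ^ n * f) %ₘ φ = C c ^ n * (f %ₘ φ) := by
  rw [← C_pow, C_mul_modByMonic]

theorem expCoeff_mul_pow_self (hφ : φ.Monic) (f : R[X]) (k : ℕ) :
    expCoeff φ (f * φ ^ k) k = f %ₘ φ := by
  rw [expCoeff, mul_comm, mul_divByMonic_cancel_left _ (hφ.pow k)]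

theorem expCoeff_zero (f : R[X]) : expCoeff φ f 0 = f %ₘ φ := by
  simp [expCoeff]

theorem expCoeff_add (hφ : φ.Monic) (f g : R[X]) (i : ℕ) :
    expCoeff φ (f + g) i = expCoeff φ f i + expCoeff φ g i := by
  rw [expCoeff, add_divByMonic' (hφ.pow i), add_modByMonic]; rfl

theorem expCoeff_C_mul (hφ : φ.Monic) (c : R) (f : R[X]) (i : ℕ) :
    expCoeff φ (C c * f) i = C c * expCoeff φ f i := by
  rw [expCoeff, C_mul_divByMonic (hφ.pow i), C_mul_modByMonic]; rfl

theorem pow_mul_divByMonic_pow [IsDomain R] (hφ : φ.Monic) (f : R[X]) (k j : ℕ) :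
    (f * φ ^ k) /ₘ φ ^ (k + j) = f /ₘ φ ^ j := by
  refine (div_modByMonic_unique _ ((f %ₘ φ ^ j) * φ ^ k) (hφ.pow _) ⟨?_, ?_⟩).1
  · rw [pow_add]
    linear_combination φ ^ k * modByMonic_add_div f (φ ^ j)
  · rw [pow_add, mul_comm (φ ^ k), degree_mul, degree_mul]
    exact WithBot.add_lt_add_right (degree_ne_bot.2 (hφ.pow k).ne_zero)
      (degree_modByMonic_lt _ (hφ.pow j))

theorem expCoeff_mul_pow_add [IsDomain R] (hφ : φ.Monic) (f : R[X]) (k j : ℕ) :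
    expCoeff φ (f * φ ^ k) (k + j) = expCoeff φ f j := by
  rw [expCoeff, pow_mul_divByMonic_pow hφ, expCoeff]

theorem expCoeff_mul_pow_of_lt (hφ : φ.Monic) (f : R[X]) {k j : ℕ} (h : j < k) :
    expCoeff φ (f * φ ^ k) j = 0 := by
  obtain ⟨d, rfl⟩ := Nat.exists_eq_add_of_lt h
  rw [expCoeff, show f * φ ^ (j + d + 1) = (f * φ ^ d * φ) * φ ^ j by ring,
    mul_comm _ (φ ^ j), mul_divByMonic_cancel_left _ (hφ.pow j), modByMonic_eq_zero_iff_dvd hφ]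
  exact dvd_mul_left _ _

theorem natDegree_le_of_expCoeff_ne_zero (hφ : φ.Monic) (hd : 0 < φ.natDegree) (f : R[X]) {i : ℕ}
    (h : expCoeff φ f i ≠ 0) : i ≤ f.natDegree := by
  by_contra! hlt
  have := Polynomial.nontrivial_iff.1 ⟨⟨_, _, h⟩⟩
  refine h ?_
  have h0 : f /ₘ φ ^ i = 0 := by
    rw [divByMonic_eq_zero_iff (hφ.pow _), degree_eq_natDegree (hφ.pow _).ne_zero, hφ.natDegree_pow]
    refine degree_le_natDegree.trans_lt ?_
    have : f.natDegree < i * φ.natDegree := by nlinarith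
    exact_mod_cast this
  simp [expCoeff, h0]

theorem map_expCoeff {S : Type*} [CommRing S] (σ : R →+* S) (hφ : φ.Monic) (f : R[X]) (i : ℕ) :
    (expCoeff φ f i).map σ = expCoeff (φ.map σ) (f.map σ) i := by
  rw [expCoeff, map_modByMonic _ hφ, map_divByMonic _ (hφ.pow i), Polynomial.map_pow, expCoeff]

theorem C_pow_dvd_expCoeff_of_dvd (hφ : φ.Monic) {π : R} {f : R[X]} {n : ℕ} (h : C π ^ n ∣ f) (i : ℕ) :
    C π ^ n ∣ expCoeff φ f i := by
  obtain ⟨g, rfl⟩ := h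
  rw [← C_pow, expCoeff_C_mul hφ]
  exact dvd_mul_right _ _

theorem mem_span_C_iff {π : R} (hφ : φ.Monic) (f : R[X]) :
    f ∈ Ideal.span {C π, φ} ↔ C π ∣ f %ₘ φ := by
  rw [Ideal.mem_span_pair]
  constructor
  · rintro ⟨x, y, rfl⟩
    rw [add_modByMonic, mul_comm x, C_mul_modByMonic, (modByMonic_eq_zero_iff_dvd hφ).2
      (dvd_mul_left φ y), add_zero]
    exact dvd_mul_right _ _
  · rintro ⟨x, hx⟩
    exact ⟨x, f /ₘ φ, by linear_combination modByMonic_add_div f φ - hx⟩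

end Expansion

/-! ### Leading terms read off from the `φ`-expansion -/

section LeadCoeff

variable {R : Type*} [CommRing R] [IsDomain R] {φ : R[X]} {π : R}
  {Γ : Type*} [AddCommMonoid Γ] [LinearOrder Γ] [IsOrderedCancelAddMonoid Γ] {α γ : Γ}

theorem lt_of_weight_le (hα : 0 < α) (hγ : 0 < γ) {m n j k : ℕ}
    (hkj : k < j) (h : m • α + j • γ ≤ n • α + k • γ) : m < n := by
  by_contra! hnm
  refine h.not_gt ?_
  have h1 : n • α ≤ m • α := nsmul_le_nsmul_left hα.le hnm
  exact add_lt_add_of_le_of_lt h1 (nsmul_lt_nsmul_left hγ hkj)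

/-- A multiple of `π ^ n * φ ^ k` has no coefficient below index `k`, and all its coefficients are
divisible by `π ^ n`. If `j ≥ k`, the weight inequality forces `n > m`. -/
theorem dvd_expCoeff_of_mem_weightIdeal (hφ : φ.Monic) (hα : 0 < α) (hγ : 0 < γ) {δ : Γ} {f : R[X]}
    (hf : f ∈ weightIdeal α γ (C π) φ δ) {m j : ℕ} (h : m • α + j • γ ≤ δ) :
    C π ^ (m + 1) ∣ expCoeff φ f j := by
  -- Taking coefficients is not `R[X]`-linear, so the induction over the ideal has to carry an
  -- arbitrary multiplier.
  suffices ∀ b : R[X], C π ^ (m + 1) ∣ expCoeff φ (b * f) j by simpa using this 1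
  induction hf using Submodule.span_induction with
  | mem x hx =>
    obtain ⟨n, k, hlt, rfl⟩ := hx
    intro b
    rw [← mul_assoc]
    rcases lt_or_ge j k with hjk | hjk
    · rw [expCoeff_mul_pow_of_lt hφ _ hjk]; exact dvd_zero _
    · have hmn : m < n := by
        by_contra! hnm
        refine (h.trans_lt hlt).not_ge ?_
        exact add_le_add (nsmul_le_nsmul_left hα.le hnm) (nsmul_le_nsmul_left hγ.le hjk)
      obtain ⟨d, rfl⟩ := Nat.exists_eq_add_of_le hjk
      rw [expCoeff_mul_pow_add hφ]
      exact (pow_dvd_pow _ hmn).trans (C_pow_dvd_expCoeff_of_dvd hφ (dvd_mul_left _ _) d)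
  | zero => intro b; simp [expCoeff]
  | add x y _ _ hx hy => intro b; rw [mul_add, expCoeff_add hφ]; exact dvd_add (hx b) (hy b)
  | smul a x _ hx => intro b; rw [smul_eq_mul, ← mul_assoc]; exact hx _

theorem IsLead.dvd_expCoeff (hφ : φ.Monic) (hα : 0 < α) (hγ : 0 < γ) {f : R[X]} {k n : ℕ}
    (hf : IsLead α γ (C π) φ f k n) : C π ^ n ∣ expCoeff φ f k := by
  obtain ⟨b, g, rfl, -, hg⟩ := hf
  rw [expCoeff_add hφ]
  refine dvd_add (C_pow_dvd_expCoeff_of_dvd hφ ⟨b * φ ^ k, by ring⟩ k) ?_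
  exact (pow_dvd_pow _ n.le_succ).trans (dvd_expCoeff_of_mem_weightIdeal hφ hα hγ hg le_rfl)

theorem IsLead.not_dvd_expCoeff (hφ : φ.Monic) (hπ : π ≠ 0) (hα : 0 < α) (hγ : 0 < γ) {f : R[X]}
    {k n : ℕ} (hf : IsLead α γ (C π) φ f k n) : ¬ C π ^ (n + 1) ∣ expCoeff φ f k := by
  obtain ⟨b, g, rfl, hb, hg⟩ := hf
  rw [expCoeff_add hφ, dvd_add_left (dvd_expCoeff_of_mem_weightIdeal hφ hα hγ hg le_rfl),
    ← mul_assoc, expCoeff_mul_pow_self hφ, mul_comm b,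
    C_pow_mul_modByMonic, pow_succ, mul_dvd_mul_iff_left (pow_ne_zero _ (C_ne_zero.2 hπ))]
  rwa [← mem_span_C_iff hφ]

/-- The factor `b` of the leading term need not be reduced modulo `φ`, so that term may spill into
indices `j > k`. There it is divisible by `π ^ n`, and the weight inequality gives `m < n`. -/
theorem IsLead.dvd_expCoeff_of_ne (hφ : φ.Monic) (hα : 0 < α) (hγ : 0 < γ) {f : R[X]} {k n : ℕ}
    (hf : IsLead α γ (C π) φ f k n) {j m : ℕ} (hj : j ≠ k)
    (h : m • α + j • γ ≤ n • α + k • γ) : C π ^ (m + 1) ∣ expCoeff φ f j := by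
  obtain ⟨b, g, rfl, -, hg⟩ := hf
  rw [expCoeff_add hφ]
  refine dvd_add ?_ (dvd_expCoeff_of_mem_weightIdeal hφ hα hγ hg h)
  rcases hj.lt_or_gt with hj | hj
  · rw [← mul_assoc, expCoeff_mul_pow_of_lt hφ _ hj]; exact dvd_zero _
  · exact (pow_dvd_pow _ (lt_of_weight_le hα hγ hj h)).trans
      (C_pow_dvd_expCoeff_of_dvd hφ ⟨b * φ ^ k, by ring⟩ _)

theorem IsLead.weight_lt (hφ : φ.Monic) (hα : 0 < α) (hγ : 0 < γ) {f : R[X]} {k n : ℕ}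
    (hf : IsLead α γ (C π) φ f k n) {j m : ℕ} (hj : j ≠ k)
    (h : ¬ C π ^ (m + 1) ∣ expCoeff φ f j) : n • α + k • γ < m • α + j • γ :=
  lt_of_not_ge fun h1 => h (hf.dvd_expCoeff_of_ne hφ hα hγ hj h1)

theorem IsLead.unique (hφ : φ.Monic) (hπ : π ≠ 0) (hα : 0 < α) (hγ : 0 < γ) {f : R[X]}
    {k n l m : ℕ} (hf : IsLead α γ (C π) φ f k n) (hf' : IsLead α γ (C π) φ f l m) : k = l := by
  by_contra hkl
  exact (hf.weight_lt hφ hα hγ (Ne.symm hkl) (hf'.not_dvd_expCoeff hφ hπ hα hγ)).asymm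
    (hf'.weight_lt hφ hα hγ hkl (hf.not_dvd_expCoeff hφ hπ hα hγ))

theorem isLead_of_expCoeff {Γ : Type*} [AddCommMonoid Γ] [LinearOrder Γ] {α γ : Γ}
    (hφ : φ.Monic) (hd : 0 < φ.natDegree)
    (hfin : ∀ a : R[X], a ≠ 0 → FiniteMultiplicity (C π) a) {f : R[X]} {k n : ℕ}
    (h1 : C π ^ n ∣ expCoeff φ f k) (h2 : ¬ C π ^ (n + 1) ∣ expCoeff φ f k)
    (h3 : ∀ j m, j ≠ k → ¬ C π ^ (m + 1) ∣ expCoeff φ f j → n • α + k • γ < m • α + j • γ) :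
    IsLead α γ (C π) φ f k n := by
  have hk : k ∈ Finset.range (f.natDegree + 1) := by
    rw [Finset.mem_range, Nat.lt_succ_iff]
    exact natDegree_le_of_expCoeff_ne_zero hφ hd f fun h => h2 (h ▸ dvd_zero _)
  obtain ⟨b, hb⟩ := h1
  refine ⟨b, ∑ j ∈ (Finset.range (f.natDegree + 1)).erase k, expCoeff φ f j * φ ^ j, ?_, ?_, ?_⟩
  · conv_lhs => rw [← sum_expCoeff hφ hd f, ← Finset.add_sum_erase _ _ hk, hb]
    ring
  · rw [mem_span_C_iff hφ]
    intro hdvd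
    refine h2 ?_
    -- A coefficient of the expansion is its own remainder, so lying in `(π, φ)` amounts to
    -- divisibility by `π`.
    have h4 : expCoeff φ f k %ₘ φ = expCoeff φ f k :=
      (modByMonic_eq_self_iff hφ).2 (degree_expCoeff_lt hφ f k)
    rw [← h4, hb, C_pow_mul_modByMonic, pow_succ]
    exact mul_dvd_mul_left _ hdvd
  · refine Ideal.sum_mem _ fun j hj => ?_
    by_cases h0 : expCoeff φ f j = 0
    · rw [h0, zero_mul]; exact Ideal.zero_mem _
    · obtain ⟨p, hp1, hp2⟩ := (hfin _ h0).exists_eq_pow_mul_and_not_dvd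
      have hnd := (hfin _ h0).not_pow_dvd_of_multiplicity_lt (Nat.lt_succ_self _)
      rw [hp1, mul_comm _ p, mul_assoc]
      exact Ideal.mul_mem_left _ _
        (Ideal.subset_span ⟨_, j, h3 j _ (Finset.ne_of_mem_erase hj) hnd, rfl⟩)

theorem exists_isLead (hφ : φ.Monic) (hd : 0 < φ.natDegree)
    (hfin : ∀ a : R[X], a ≠ 0 → FiniteMultiplicity (C π) a) (hα : 0 < α)
    (hinj : ∀ m n j k : ℕ, n • α + k • γ = m • α + j • γ → j = k) {f : R[X]} (hf : f ≠ 0) :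
    ∃ k n, IsLead α γ (C π) φ f k n := by
  classical
  set T := (Finset.range (f.natDegree + 1)).filter fun k => expCoeff φ f k ≠ 0
  have hT : T.Nonempty := by
    by_contra! h
    refine hf ?_
    rw [← sum_expCoeff hφ hd f]
    refine Finset.sum_eq_zero fun i hi => ?_
    by_contra h0
    have : i ∈ T := Finset.mem_filter.2 ⟨hi, left_ne_zero_of_mul h0⟩
    simp [h] at this
  obtain ⟨k, hk, hmin⟩ := T.exists_min_image
    (fun k => multiplicity (C π) (expCoeff φ f k) • α + k • γ) hT
  have hk0 := (Finset.mem_filter.1 hk).2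
  refine ⟨k, _, isLead_of_expCoeff hφ hd hfin (pow_multiplicity_dvd _ _)
    ((hfin _ hk0).not_pow_dvd_of_multiplicity_lt (Nat.lt_succ_self _)) fun j m hj hm => ?_⟩
  have hj0 : expCoeff φ f j ≠ 0 := fun h => hm (h ▸ dvd_zero _)
  have hjT : j ∈ T := Finset.mem_filter.2
    ⟨Finset.mem_range.2 (Nat.lt_succ_of_le (natDegree_le_of_expCoeff_ne_zero hφ hd f hj0)), hj0⟩
  -- The minimum is attained at one index only: by `hinj` equal weights force equal indices.
  refine lt_of_le_of_ne ((hmin j hjT).trans ?_) fun h => hj (hinj _ _ _ _ h)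
  have : multiplicity (C π) (expCoeff φ f j) ≤ m := by
    by_contra! h
    exact hm ((pow_dvd_pow _ h).trans (pow_multiplicity_dvd _ _))
  exact add_le_add_left (nsmul_le_nsmul_left hα.le this) _

end LeadCoeff

/-! ### End points of the edge of a given slope -/

section Edge

variable {R : Type*} [CommRing R] [IsDomain R] {φ : R[X]} {π : R}

/-- Among the points `(i, u i)` of the `φ`-Newton polygon of `f` that minimize `u i + i * lam`,
`(k, n)` is the one with smallest `ε * i`. -/
def IsEdgeEnd (π : R) (φ f : R[X]) (lam : ℚ) (ε : ℤ) (k n : ℕ) : Prop :=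
  IsLead (toLex ((1 : ℚ), (0 : ℤ))) (toLex (lam, ε)) (C π) φ f k n

theorem weight_toLex (lam : ℚ) (ε : ℤ) (n k : ℕ) :
    n • toLex ((1 : ℚ), (0 : ℤ)) + k • toLex (lam, ε) = toLex (n + k * lam, k * ε) := by
  change toLex (n • ((1 : ℚ), (0 : ℤ)) + k • (lam, ε)) = _
  simp

theorem zero_lt_toLex_one : (0 : ℚ ×ₗ ℤ) < toLex ((1 : ℚ), (0 : ℤ)) :=
  Prod.Lex.toLex_lt_toLex.2 (Or.inl zero_lt_one)

theorem zero_lt_toLex {lam : ℚ} (hl : 0 < lam) (ε : ℤ) : (0 : ℚ ×ₗ ℤ) < toLex (lam, ε) :=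
  Prod.Lex.toLex_lt_toLex.2 (Or.inl hl)

variable {lam : ℚ} {ε : ℤ} {f : R[X]} {k n s a t b : ℕ}

theorem IsEdgeEnd.dvd (h : IsEdgeEnd π φ f lam ε k n) (hφ : φ.Monic) (hl : 0 < lam) :
    C π ^ n ∣ expCoeff φ f k :=
  IsLead.dvd_expCoeff hφ zero_lt_toLex_one (zero_lt_toLex hl ε) h

theorem IsEdgeEnd.not_dvd (h : IsEdgeEnd π φ f lam ε k n) (hφ : φ.Monic) (hπ : π ≠ 0)
    (hl : 0 < lam) : ¬ C π ^ (n + 1) ∣ expCoeff φ f k :=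
  IsLead.not_dvd_expCoeff hφ hπ zero_lt_toLex_one (zero_lt_toLex hl ε) h

/-- The hypothesis on `m` says that there is a point over `j` of ordinate at most `m`; vanishing
coefficients are thereby excluded. -/
theorem IsEdgeEnd.le_or (h : IsEdgeEnd π φ f lam ε k n) (hφ : φ.Monic) (hl : 0 < lam) {j m : ℕ}
    (hm : ¬ C π ^ (m + 1) ∣ expCoeff φ f j) :
    (n + k * lam : ℚ) ≤ m + j * lam ∧ ((n + k * lam : ℚ) = m + j * lam → k * ε ≤ j * ε) := by
  rcases eq_or_ne j k with rfl | hj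
  · have hnm : n ≤ m := by
      by_contra! hlt
      exact hm ((pow_dvd_pow _ hlt).trans (h.dvd hφ hl))
    have : (n : ℚ) ≤ m := by exact_mod_cast hnm
    exact ⟨by linarith, fun _ => le_rfl⟩
  · have := IsLead.weight_lt hφ zero_lt_toLex_one (zero_lt_toLex hl ε) h hj hm
    rw [weight_toLex, weight_toLex, Prod.Lex.toLex_lt_toLex] at this
    rcases this with h1 | ⟨h1, h2⟩
    · exact ⟨h1.le, fun h3 => absurd h3 h1.ne⟩
    · exact ⟨h1.le, fun _ => h2.le⟩

theorem IsEdgeEnd.unique (hφ : φ.Monic) (hπ : π ≠ 0) (hl : 0 < lam)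
    (h : IsEdgeEnd π φ f lam ε s a) (h' : IsEdgeEnd π φ f lam ε t b) : s = t :=
  IsLead.unique hφ hπ zero_lt_toLex_one (zero_lt_toLex hl ε) h h'

theorem exists_isEdgeEnd (hφ : φ.Monic) (hd : 0 < φ.natDegree)
    (hfin : ∀ a : R[X], a ≠ 0 → FiniteMultiplicity (C π) a) (lam : ℚ) (hε : ε ≠ 0) (hf : f ≠ 0) :
    ∃ k n, IsEdgeEnd π φ f lam ε k n := by
  refine exists_isLead hφ hd hfin zero_lt_toLex_one (fun m n j k h => ?_) hf
  rw [weight_toLex, weight_toLex, toLex_inj, Prod.mk.injEq] at h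
  exact_mod_cast (mul_right_cancel₀ hε h.2).symm

theorem IsEdgeEnd.weight_eq (hφ : φ.Monic) (hπ : π ≠ 0) (hl : 0 < lam)
    (h : IsEdgeEnd π φ f lam 1 s a) (h' : IsEdgeEnd π φ f lam (-1) t b) :
    (a + s * lam : ℚ) = b + t * lam :=
  le_antisymm (h.le_or hφ hl (h'.not_dvd hφ hπ hl)).1 (h'.le_or hφ hl (h.not_dvd hφ hπ hl)).1

theorem IsEdgeEnd.le_and_le (hφ : φ.Monic) (hπ : π ≠ 0) (hl : 0 < lam)
    (h : IsEdgeEnd π φ f lam 1 s a) (h' : IsEdgeEnd π φ f lam (-1) t b) {j m : ℕ}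
    (hm : ¬ C π ^ (m + 1) ∣ expCoeff φ f j) (heq : (a + s * lam : ℚ) = m + j * lam) :
    s ≤ j ∧ j ≤ t := by
  have h1 := (h.le_or hφ hl hm).2 heq
  have h2 := (h'.le_or hφ hl hm).2 ((h.weight_eq hφ hπ hl h').symm.trans heq)
  omega

theorem IsEdgeEnd.le (hφ : φ.Monic) (hπ : π ≠ 0) (hl : 0 < lam)
    (h : IsEdgeEnd π φ f lam 1 s a) (h' : IsEdgeEnd π φ f lam (-1) t b) : s ≤ t :=
  (h.le_and_le hφ hπ hl h' (h'.not_dvd hφ hπ hl) (h.weight_eq hφ hπ hl h')).1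

theorem IsEdgeEnd.den_dvd (hφ : φ.Monic) (hπ : π ≠ 0) (hl : 0 < lam)
    (h : IsEdgeEnd π φ f lam 1 s a) (h' : IsEdgeEnd π φ f lam (-1) t b) : lam.den ∣ t - s := by
  have hst := h.le hφ hπ hl h'
  rcases hst.eq_or_lt with rfl | hlt
  · simp
  have h1 : lam = Rat.divInt (a - b) ((t - s : ℕ) : ℤ) := by
    have h2 := h.weight_eq hφ hπ hl h'
    have h3 : (t : ℚ) - s ≠ 0 := sub_ne_zero.2 (by exact_mod_cast hlt.ne')
    rw [Rat.divInt_eq_div]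
    push_cast [Nat.cast_sub hst]
    rw [eq_div_iff h3]
    linarith
  rw [← Int.natCast_dvd_natCast, h1]
  exact Rat.den_dvd _ _

/-- The side found is the first one, which leaves `(0, u 0)`: `-lam` is the smallest slope from that
point to another point. It is negative because `u 0 > 0` while some point lies on the axis. -/
theorem exists_edge (hφ : φ.Monic) (hd : 0 < φ.natDegree) (hπ : π ≠ 0)
    (hfin : ∀ a : R[X], a ≠ 0 → FiniteMultiplicity (C π) a) (hf : ¬ C π ∣ f)
    (hJ : f ∈ Ideal.span {C π, φ}) (hdvd : ¬ φ ∣ f) :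
    ∃ lam : ℚ, 0 < lam ∧ ∃ s a t b, IsEdgeEnd π φ f lam 1 s a ∧ IsEdgeEnd π φ f lam (-1) t b ∧
      s < t := by
  classical
  have hf0 : f ≠ 0 := fun h => hdvd (h ▸ dvd_zero _)
  set u : ℕ → ℕ := fun k => multiplicity (C π) (expCoeff φ f k)
  have hu : ∀ k, expCoeff φ f k ≠ 0 → ¬ C π ^ (u k + 1) ∣ expCoeff φ f k := fun k h =>
    (hfin _ h).not_pow_dvd_of_multiplicity_lt (Nat.lt_succ_self _)
  have h0 : expCoeff φ f 0 ≠ 0 := by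
    rwa [expCoeff_zero, Ne, modByMonic_eq_zero_iff_dvd hφ]
  have hu0 : 0 < u 0 := by
    refine Nat.pos_of_ne_zero fun h => hu 0 h0 ?_
    rw [h, zero_add, pow_one, expCoeff_zero]
    exact (mem_span_C_iff hφ f).1 hJ
  obtain ⟨k, hk⟩ : ∃ k, ¬ C π ∣ expCoeff φ f k := by
    by_contra! h
    refine hf ?_
    rw [← sum_expCoeff hφ hd f]
    exact Finset.dvd_sum fun i _ => (h i).mul_right _
  have hk0 : expCoeff φ f k ≠ 0 := fun h => hk (h ▸ dvd_zero _)
  have huk : u k = 0 := by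
    by_contra h
    exact hk ((dvd_pow_self _ h).trans (pow_multiplicity_dvd _ _))
  -- Zero coefficients must be left out: their `multiplicity` is only a default value.
  set T := (Finset.range (f.natDegree + 1)).filter fun k => k ≠ 0 ∧ expCoeff φ f k ≠ 0
  have hT : ∀ j, j ≠ 0 → expCoeff φ f j ≠ 0 → j ∈ T := fun j hj hj' =>
    Finset.mem_filter.2 ⟨Finset.mem_range.2
      (Nat.lt_succ_of_le (natDegree_le_of_expCoeff_ne_zero hφ hd f hj')), hj, hj'⟩
  have hkne : k ≠ 0 := by rintro rfl; omega
  have hkT := hT k hkne hk0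
  obtain ⟨l, hl, hmax⟩ := T.exists_max_image (fun j => ((u 0 : ℚ) - u j) / j) ⟨k, hkT⟩
  obtain ⟨hl0, hla⟩ := (Finset.mem_filter.1 hl).2
  set lam := ((u 0 : ℚ) - u l) / l with hlam
  have hu0' : (0 : ℚ) < u 0 := by exact_mod_cast hu0
  have hkpos : (0 : ℚ) < k := by exact_mod_cast Nat.pos_of_ne_zero hkne
  have hpos : 0 < lam := by
    refine lt_of_lt_of_le ?_ (hmax k hkT)
    simp only [huk]
    push_cast
    rw [sub_zero]
    positivity
  obtain ⟨s, a, hs⟩ := exists_isEdgeEnd hφ hd hfin lam one_ne_zero hf0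
  obtain ⟨t, b, ht⟩ := exists_isEdgeEnd hφ hd hfin lam (neg_ne_zero.2 one_ne_zero) hf0
  have hl' : (0 : ℚ) < l := by exact_mod_cast Nat.pos_of_ne_zero hl0
  have hleq : (u 0 : ℚ) = u l + l * lam := by rw [hlam]; field_simp; ring
  -- By maximality of `lam`, no point lies below the line of slope `-lam` through `(0, u 0)`. Hence
  -- the points over `0` and `l` both lie on the edge.
  have hsa : (u 0 : ℚ) ≤ a + s * lam := by
    have hs0 : expCoeff φ f s ≠ 0 := fun h => hs.not_dvd hφ hπ hpos (h ▸ dvd_zero _)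
    have hua : (u s : ℚ) ≤ a := by
      have : u s ≤ a := by
        by_contra! h
        exact hs.not_dvd hφ hπ hpos ((pow_dvd_pow _ h).trans (pow_multiplicity_dvd _ _))
      exact_mod_cast this
    rcases eq_or_ne s 0 with rfl | hsne
    · simpa using hua
    · have h1 := hmax s (hT s hsne hs0)
      have h2 : (0 : ℚ) < s := by exact_mod_cast Nat.pos_of_ne_zero hsne
      rw [div_le_iff₀ h2] at h1
      linarith
  have h1 := hs.le_or hφ hpos (hu 0 h0)
  have heq : (a + s * lam : ℚ) = u 0 := le_antisymm (by simpa using h1.1) hsa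
  have h2 := hs.le_and_le hφ hπ hpos ht (hu 0 h0) (by simpa using heq)
  have h3 := hs.le_and_le hφ hπ hpos ht (hu l hla) (heq.trans hleq)
  exact ⟨lam, hpos, s, a, t, b, hs, ht, by omega⟩

end Edge

/-! ### Comparison with the Newton polygon -/

section Valuation

variable {K L : Type*} [Field K] [Field L] {v : Valuation K ℤᵐ⁰} {w : Valuation L ℤᵐ⁰}

/-- The map on valuation rings given by an extension of valued fields. -/
def valuationSubringMap (v : Valuation K ℤᵐ⁰) (w : Valuation L ℤᵐ⁰) (σ : K →+* L)
    (hσ : ∀ x, w (σ x) = v x) : v.valuationSubring →+* w.valuationSubring :=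
  (σ.comp v.valuationSubring.subtype).codRestrict w.valuationSubring.toSubring fun x => by
    change w (σ x) ≤ 1
    rw [hσ]
    exact x.2

theorem coe_valuationSubringMap (σ : K →+* L) (hσ : ∀ x, w (σ x) = v x)
    (x : v.valuationSubring) : (valuationSubringMap v w σ hσ x : L) = σ x := rfl

theorem pow_dvd_iff_le {π : w.valuationSubring} (hπ : w (π : L) = WithZero.exp (-1)) (n : ℕ)
    (x : w.valuationSubring) : π ^ n ∣ x ↔ w (x : L) ≤ WithZero.exp (-(n : ℤ)) := by
  have hpow : w ((π : L) ^ n) = WithZero.exp (-(n : ℤ)) := by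
    rw [map_pow, hπ, ← WithZero.exp_nsmul]
    simp
  constructor
  · rintro ⟨y, rfl⟩
    push_cast
    rw [map_mul, hpow]
    exact mul_le_of_le_one_right' y.2
  · intro h
    have h0 : (π : L) ^ n ≠ 0 := fun h0 => by
      rw [h0, map_zero] at hpow
      exact WithZero.exp_ne_zero hpow.symm
    refine ⟨⟨x / (π : L) ^ n, ?_⟩, Subtype.ext ?_⟩
    · change w _ ≤ 1
      rw [map_div₀, hpow]
      exact div_le_one_of_le₀ h zero_le
    · push_cast
      field_simp

theorem finiteMultiplicity_C {π : w.valuationSubring} (hπ : w (π : L) = WithZero.exp (-1))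
    {p : w.valuationSubring[X]} (hp : p ≠ 0) : FiniteMultiplicity (C π) p := by
  obtain ⟨k, hk⟩ : ∃ k, p.coeff k ≠ 0 := by
    by_contra! h
    exact hp (ext h)
  have hk' : w (p.coeff k : L) ≠ 0 := by simpa using hk
  refine ⟨(-WithZero.log (w (p.coeff k : L))).toNat, fun h => ?_⟩
  rw [← C_pow, C_dvd_iff_dvd_coeff] at h
  have h1 := (pow_dvd_iff_le hπ _ _).1 (h k)
  rw [← WithZero.exp_log hk', WithZero.exp_le_exp] at h1
  simp only [WithZero.log_exp] at h1
  omega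

theorem polyVal_eq_coe {p : v.valuationSubring[X]} {c : ℤ} (h : polyVal v p = c) :
    (∀ k, v (p.coeff k : K) ≤ WithZero.exp (-c)) ∧ ∃ k, v (p.coeff k : K) = WithZero.exp (-c) := by
  constructor
  · intro k
    by_cases hk : p.coeff k = 0
    · simp [hk]
    · have hk' : v (p.coeff k : K) ≠ 0 := by simpa using hk
      have h1 : polyVal v p ≤ ((-WithZero.log (v (p.coeff k : K)) : ℤ) : WithTop ℤ) :=
        Finset.inf_le (mem_support_iff.2 hk)
      rw [h] at h1
      rw [← WithZero.exp_log hk', WithZero.exp_le_exp]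
      have h2 : c ≤ -WithZero.log (v (p.coeff k : K)) := WithTop.coe_le_coe.1 h1
      omega
  · have hne : p.support.Nonempty := by
      rw [Finset.nonempty_iff_ne_empty]
      intro h0
      rw [polyVal, h0, Finset.inf_empty] at h
      exact WithTop.top_ne_coe h
    obtain ⟨k, hk, hk1⟩ := Finset.exists_mem_eq_inf _ hne fun k =>
      ((-WithZero.log (v (p.coeff k : K)) : ℤ) : WithTop ℤ)
    have hk' : v (p.coeff k : K) ≠ 0 := by simpa using hk
    refine ⟨k, ?_⟩
    rw [← WithZero.exp_log hk', WithZero.exp_inj]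
    have h2 : -WithZero.log (v (p.coeff k : K)) = c := WithTop.coe_injective (hk1.symm.trans h)
    omega

theorem exists_polyVal_eq_coe {p : v.valuationSubring[X]} (hp : p ≠ 0) :
    ∃ c : ℤ, polyVal v p = c := by
  obtain ⟨k, -, hk⟩ := Finset.exists_mem_eq_inf _ (support_nonempty.2 hp) fun k =>
      ((-WithZero.log (v (p.coeff k : K)) : ℤ) : WithTop ℤ)
  exact ⟨_, hk⟩

variable {σ : K →+* L} {hσ : ∀ x, w (σ x) = v x} {π : w.valuationSubring}

theorem C_pow_dvd_map_iff (hπ : w (π : L) = WithZero.exp (-1)) (n : ℕ)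
    (p : v.valuationSubring[X]) : C π ^ n ∣ p.map (valuationSubringMap v w σ hσ) ↔
      ∀ k, v (p.coeff k : K) ≤ WithZero.exp (-(n : ℤ)) := by
  rw [← C_pow, C_dvd_iff_dvd_coeff]
  refine forall_congr' fun k => ?_
  rw [pow_dvd_iff_le hπ, coeff_map, coe_valuationSubringMap, hσ]

theorem exists_nat_of_polyVal_eq (hπ : w (π : L) = WithZero.exp (-1)) {p : v.valuationSubring[X]}
    {c : ℤ} (h : polyVal v p = c) : ∃ n : ℕ, c = n ∧
      C π ^ n ∣ p.map (valuationSubringMap v w σ hσ) ∧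
      ¬ C π ^ (n + 1) ∣ p.map (valuationSubringMap v w σ hσ) := by
  obtain ⟨h1, k, hk⟩ := polyVal_eq_coe h
  have hc : 0 ≤ c := by
    have : v (p.coeff k : K) ≤ 1 := (p.coeff k).2
    rw [hk, ← WithZero.exp_zero, WithZero.exp_le_exp] at this
    omega
  lift c to ℕ using hc
  refine ⟨c, rfl, (C_pow_dvd_map_iff hπ _ _).2 h1, fun h2 => ?_⟩
  have := (C_pow_dvd_map_iff hπ _ _).1 h2 k
  rw [hk, WithZero.exp_le_exp] at this
  omega

theorem polyVal_eq_of_dvd (hπ : w (π : L) = WithZero.exp (-1)) {p : v.valuationSubring[X]}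
    {n : ℕ} (h1 : C π ^ n ∣ p.map (valuationSubringMap v w σ hσ))
    (h2 : ¬ C π ^ (n + 1) ∣ p.map (valuationSubringMap v w σ hσ)) : polyVal v p = (n : ℤ) := by
  have hp : p ≠ 0 := by
    rintro rfl
    exact h2 (by simp)
  obtain ⟨c, hc⟩ := exists_polyVal_eq_coe hp
  obtain ⟨m, rfl, h3, h4⟩ := exists_nat_of_polyVal_eq (σ := σ) (hσ := hσ) hπ hc
  have : m = n := by
    by_contra hmn
    rcases Ne.lt_or_gt hmn with h | h
    · exact h4 ((pow_dvd_pow _ h).trans h1)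
    · exact h2 ((pow_dvd_pow _ h).trans h3)
  rw [hc, this]

-- Expansions commute with the base change, which preserves valuations, so an edge found over `L` is
-- a side of the polygon over `K`. Minimality of `u i + i * lam` is the supporting line condition,
-- and the tie-break confines the points on that line to the segment.
open scoped Classical in
theorem mem_negSides_of_isEdgeEnd (hπ : w (π : L) = WithZero.exp (-1)) {φ f : v.valuationSubring[X]}
    (hφ : φ.Monic) (hd : 0 < φ.natDegree) {lam : ℚ} (hl : 0 < lam) {s a t b : ℕ}
    (hs : IsEdgeEnd π (φ.map (valuationSubringMap v w σ hσ))
      (f.map (valuationSubringMap v w σ hσ)) lam 1 s a)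
    (ht : IsEdgeEnd π (φ.map (valuationSubringMap v w σ hσ))
      (f.map (valuationSubringMap v w σ hσ)) lam (-1) t b) (hst : s < t) :
    (s, t) ∈ negSides v φ f ∧ slope (newtonPoint v φ f) s t = -lam := by
  have hφ' := hφ.map (valuationSubringMap v w σ hσ)
  have hπ0 : π ≠ 0 := by
    rintro rfl
    rw [ZeroMemClass.coe_zero, map_zero] at hπ
    exact WithZero.exp_ne_zero hπ.symm
  have hus : newtonPoint v φ f s = (a : ℤ) := by
    refine polyVal_eq_of_dvd (σ := σ) (hσ := hσ) hπ ?_ ?_ <;> rw [map_expCoeff _ hφ]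
    exacts [hs.dvd hφ' hl, hs.not_dvd hφ' hπ0 hl]
  have hut : newtonPoint v φ f t = (b : ℤ) := by
    refine polyVal_eq_of_dvd (σ := σ) (hσ := hσ) hπ ?_ ?_ <;> rw [map_expCoeff _ hφ]
    exacts [ht.dvd hφ' hl, ht.not_dvd hφ' hπ0 hl]
  have hwt := hs.weight_eq hφ' hπ0 hl ht
  have hst' : (0 : ℚ) < t - s := sub_pos.2 (by exact_mod_cast hst)
  have hslope : slope (newtonPoint v φ f) s t = -lam := by
    rw [slope, hus, hut, WithTop.untopD_coe, WithTop.untopD_coe, div_eq_iff hst'.ne']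
    push_cast
    linarith
  have hrange : ∀ i (c : ℤ), newtonPoint v φ f i = c → i ∈ Finset.range (f.natDegree + 1) := by
    intro i c h
    refine Finset.mem_range.2 (Nat.lt_succ_of_le (natDegree_le_of_expCoeff_ne_zero hφ hd f ?_))
    intro h0
    rw [newtonPoint, h0] at h
    simp [polyVal] at h
  refine ⟨?_, hslope⟩
  rw [negSides, Finset.mem_filter]
  refine ⟨Finset.mk_mem_product (hrange s _ hus) (hrange t _ hut),
    ⟨hst, a, b, hus, hut, fun i c hc => ?_⟩, ?_⟩
  · obtain ⟨m, rfl, -, hm⟩ := exists_nat_of_polyVal_eq (σ := σ) (hσ := hσ) hπ hc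
    rw [map_expCoeff _ hφ] at hm
    -- The line through both end points has ordinate `a + s * lam - i * lam` at the abscissa `i`.
    have key : ((t : ℚ) - i) * a + ((i : ℚ) - s) * b = (t - s) * (a + s * lam - i * lam) := by
      linear_combination (s - i : ℚ) * hwt
    constructor
    · have h1 := (hs.le_or hφ' hl hm).1
      have : ((t : ℚ) - i) * a + ((i : ℚ) - s) * b ≤ (t - s) * m := by
        rw [key]
        exact mul_le_mul_of_nonneg_left (by linarith) hst'.le
      exact_mod_cast this
    · intro h
      have : ((t : ℚ) - i) * a + ((i : ℚ) - s) * b = (t - s) * m := by exact_mod_cast h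
      rw [key] at this
      have := mul_left_cancel₀ hst'.ne' this
      exact hs.le_and_le hφ' hπ0 hl ht hm (by linarith)
  · change slope (newtonPoint v φ f) s t < 0
    rw [hslope]
    linarith

end Valuation

/-! ### Counting factors -/

section Count

variable {K L : Type*} [Field K] [Field L] {v : Valuation K ℤᵐ⁰} {w : Valuation L ℤᵐ⁰}

theorem exists_valuationSubring_eq_exp_neg_one (hv : Function.Surjective v) :
    ∃ π : v.valuationSubring, v (π : K) = WithZero.exp (-1) := by
  obtain ⟨x, hx⟩ := hv (WithZero.exp (-1))
  refine ⟨⟨x, ?_⟩, hx⟩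
  change v x ≤ 1
  rw [hx, ← WithZero.exp_zero, WithZero.exp_le_exp]
  norm_num

theorem residue_eq_zero_iff_lt (x : w.valuationSubring) :
    IsLocalRing.residue w.valuationSubring x = 0 ↔ w (x : L) < 1 := by
  rw [IsLocalRing.residue_eq_zero_iff, Valuation.mem_maximalIdeal_iff]

theorem residue_eq_zero_iff_dvd {π : w.valuationSubring} (hπ : w (π : L) = WithZero.exp (-1))
    (x : w.valuationSubring) : IsLocalRing.residue w.valuationSubring x = 0 ↔ π ∣ x := by
  rw [residue_eq_zero_iff_lt, ← pow_one π, pow_dvd_iff_le hπ]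
  by_cases hx : w (x : L) = 0
  · simp [hx]
  · rw [← WithZero.exp_log hx, ← WithZero.exp_zero, WithZero.exp_lt_exp, WithZero.exp_le_exp]
    simp only [Nat.cast_one]
    omega

/-- This makes `(π, φ)` prime when the reduction of `φ` is irreducible, and turns divisibility of
reductions into membership. -/
theorem span_C_eq_comap {π : w.valuationSubring} (hπ : w (π : L) = WithZero.exp (-1))
    (φ : w.valuationSubring[X]) :
    Ideal.span {C π, φ} = (Ideal.span {reduction w φ}).comap
      (mapRingHom (IsLocalRing.residue w.valuationSubring)) := by
  have h := Ideal.comap_map_of_surjective (mapRingHom (IsLocalRing.residue w.valuationSubring))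
    (map_surjective _ IsLocalRing.residue_surjective) (Ideal.span {φ})
  rw [Ideal.map_span, Set.image_singleton] at h
  rw [show reduction w φ = mapRingHom (IsLocalRing.residue w.valuationSubring) φ from rfl, h,
    Ideal.span_insert, sup_comm]
  congr 1
  ext p
  rw [Ideal.mem_span_singleton, C_dvd_iff_dvd_coeff, Ideal.mem_comap, Ideal.mem_bot,
    Polynomial.ext_iff]
  refine forall_congr' fun k => ?_
  rw [← residue_eq_zero_iff_dvd hπ, coe_mapRingHom, coeff_map, coeff_zero]

variable {σ : K →+* L} {hσ : ∀ x, w (σ x) = v x}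

/-- Approximation by elements of `K` makes the map of residue fields surjective, so reductions
irreducible over `K` stay irreducible over `L`. -/
theorem exists_residueField_equiv (hres : ∀ x, w x ≤ 1 → ∃ y, w (x - σ y) < 1) :
    ∃ τ : IsLocalRing.ResidueField v.valuationSubring ≃+*
        IsLocalRing.ResidueField w.valuationSubring,
      ∀ p, reduction w (p.map (valuationSubringMap v w σ hσ)) = mapEquiv τ (reduction v p) := by
  set ι := valuationSubringMap v w σ hσ
  have hloc : IsLocalHom ι := by
    refine ⟨fun x hx => ?_⟩
    by_contra hx'
    have h1 := (residue_eq_zero_iff_lt x).1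
      ((IsLocalRing.residue_eq_zero_iff x).2 ((IsLocalRing.mem_maximalIdeal _).2 hx'))
    have h2 : w (ι x : L) < 1 := by rw [coe_valuationSubringMap, hσ]; exact h1
    exact (IsLocalRing.mem_maximalIdeal _).1
      ((IsLocalRing.residue_eq_zero_iff _).1 ((residue_eq_zero_iff_lt (ι x)).2 h2)) hx
  have hsurj : Function.Surjective (IsLocalRing.ResidueField.map ι) := by
    intro z
    obtain ⟨x, rfl⟩ := IsLocalRing.residue_surjective z
    obtain ⟨y, hy⟩ := hres x x.2
    have hy1 : v y ≤ 1 := by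
      rw [← hσ, ← sub_sub_cancel (x : L) (σ y)]
      exact (w.map_sub _ _).trans (max_le x.2 hy.le)
    refine ⟨IsLocalRing.residue _ ⟨y, hy1⟩, ?_⟩
    rw [IsLocalRing.ResidueField.map_residue, eq_comm, ← sub_eq_zero, ← map_sub,
      residue_eq_zero_iff_lt]
    exact hy
  refine ⟨RingEquiv.ofBijective _ ⟨(IsLocalRing.ResidueField.map ι).injective, hsurj⟩, fun p => ?_⟩
  rw [mapEquiv_apply, reduction, reduction, map_map, map_map]
  rfl

theorem exists_reduction_dvd {F : Type*} [Field F] {n : ℕ} {φ : Fin n → F[X]} {e : Fin n → ℕ}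
    (hφ : ∀ i, Irreducible (φ i)) {g : F[X]} (hg : g ∣ ∏ i, φ i ^ e i) (hg' : ¬ IsUnit g) :
    ∃ i, φ i ∣ g := by
  have h0 : g ≠ 0 := by
    rintro rfl
    exact Finset.prod_ne_zero_iff.2 (fun i _ => pow_ne_zero _ (hφ i).ne_zero) (zero_dvd_iff.1 hg)
  obtain ⟨q, hq, hqg⟩ := WfDvdMonoid.exists_irreducible_factor hg' h0
  obtain ⟨i, -, hi⟩ := (hq.prime.dvd_finsetProd_iff _).1 (hqg.trans hg)
  exact ⟨i, ((hq.associated_of_dvd (hφ i) (hq.prime.dvd_of_dvd_pow hi)).dvd').trans hqg⟩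

/-- A factorization of `f` into `N` monic nonconstant polynomials over the valuation ring of an
immediate extension has at most as many factors as the sum of the degrees of the sides. -/
theorem card_le_sum_sideDegree (hσ : ∀ x, w (σ x) = v x)
    (hres : ∀ x, w x ≤ 1 → ∃ y, w (x - σ y) < 1) (hv : Function.Surjective v)
    (f : v.valuationSubring[X]) (r : ℕ) (φ : Fin r → v.valuationSubring[X]) (n : Fin r → ℕ)
    (hφ : ∀ i, (φ i).Monic) (hirr : ∀ i, Irreducible (reduction v (φ i)))
    (hfac : reduction v f = ∏ i, reduction v (φ i) ^ n i) (hdvd : ∀ i, ¬ φ i ∣ f)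
    {N : ℕ} (g : Fin N → w.valuationSubring[X]) (hg : ∀ j, (g j).Monic)
    (hgd : ∀ j, 0 < (g j).natDegree)
    (hfg : f.map (valuationSubringMap v w σ hσ) = ∏ j, g j) :
    N ≤ ∑ i, ∑ p ∈ negSides v (φ i) f, sideDegree (newtonPoint v (φ i) f) p.1 p.2 := by
  classical
  set ι := valuationSubringMap v w σ hσ
  have hinj : Function.Injective ι := fun x y h =>
    Subtype.ext (σ.injective (congrArg Subtype.val h))
  obtain ⟨π₀, hπ₀⟩ := exists_valuationSubring_eq_exp_neg_one hv
  set π := ι π₀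
  have hπ : w (π : L) = WithZero.exp (-1) := by
    rw [coe_valuationSubringMap, hσ, hπ₀]
  have hπ0 : π ≠ 0 := by
    intro h
    rw [h, ZeroMemClass.coe_zero, map_zero] at hπ
    exact WithZero.exp_ne_zero hπ.symm
  have hfin : ∀ p : w.valuationSubring[X], p ≠ 0 → FiniteMultiplicity (C π) p := fun p hp =>
    finiteMultiplicity_C hπ hp
  have hφ' : ∀ i, ((φ i).map ι).Monic := fun i => (hφ i).map ι
  have hd : ∀ i, 0 < (φ i).natDegree := fun i => by
    have := (hirr i).natDegree_pos
    rwa [reduction, (hφ i).natDegree_map] at this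
  have hd' : ∀ i, 0 < ((φ i).map ι).natDegree := fun i => by rw [(hφ i).natDegree_map]; exact hd i
  obtain ⟨τ, hτ⟩ : ∃ τ : IsLocalRing.ResidueField v.valuationSubring ≃+*
      IsLocalRing.ResidueField w.valuationSubring,
      ∀ p, reduction w (p.map ι) = mapEquiv τ (reduction v p) := exists_residueField_equiv hres
  have hirr' : ∀ i, Irreducible (reduction w ((φ i).map ι)) := fun i => by
    rw [hτ]
    exact (MulEquiv.irreducible_iff _).2 (hirr i)
  have hJ : ∀ i, (Ideal.span {C π, (φ i).map ι}).IsPrime := fun i => by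
    rw [span_C_eq_comap hπ]
    have := (Ideal.span_singleton_prime (hirr' i).ne_zero).2 (hirr' i).prime
    exact Ideal.comap_isPrime _ _
  have hfac' : reduction w (f.map ι) = ∏ i, reduction w ((φ i).map ι) ^ n i := by
    simp only [hτ, hfac, map_prod, map_pow]
  have hred : ∀ j, ∃ i, g j ∈ Ideal.span {C π, (φ i).map ι} := by
    intro j
    have hu : ¬ IsUnit (reduction w (g j)) := fun h => by
      have := natDegree_eq_zero_of_isUnit h
      rw [reduction, (hg j).natDegree_map] at this
      exact (hgd j).ne' this
    have hdv : reduction w (g j) ∣ ∏ i, reduction w ((φ i).map ι) ^ n i := by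
      rw [← hfac', hfg]
      exact Polynomial.map_dvd _ (Finset.dvd_prod_of_mem g (Finset.mem_univ j))
    obtain ⟨i, hi⟩ := exists_reduction_dvd hirr' hdv hu
    refine ⟨i, ?_⟩
    rw [span_C_eq_comap hπ, Ideal.mem_comap, Ideal.mem_span_singleton]
    exact hi
  choose i hi using hred
  have hgdvd : ∀ i j, ¬ (φ i).map ι ∣ g j := fun i j h => by
    have h1 : (φ i).map ι ∣ f.map ι := by
      rw [hfg]
      exact h.trans (Finset.dvd_prod_of_mem g (Finset.mem_univ j))
    rw [← modByMonic_eq_zero_iff_dvd (hφ' i), ← map_modByMonic _ (hφ i),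
      Polynomial.map_eq_zero_iff hinj, modByMonic_eq_zero_iff_dvd (hφ i)] at h1
    exact hdvd i h1
  have hg0 : ∀ j, g j ≠ 0 := fun j => (hg j).ne_zero
  have hf0 : f.map ι ≠ 0 := by rw [hfg]; exact Finset.prod_ne_zero_iff.2 fun j _ => hg0 j
  have hgC : ∀ j, ¬ C π ∣ g j := fun j h => by
    have h1 := (C_dvd_iff_dvd_coeff _ _).1 h (g j).natDegree
    rw [(hg j).coeff_natDegree, ← residue_eq_zero_iff_dvd hπ, map_one] at h1
    exact one_ne_zero h1
  have hstart : ∀ i lam j, ∃ s a, IsEdgeEnd π ((φ i).map ι) (g j) lam 1 s a := fun i lam j =>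
    exists_isEdgeEnd (hφ' i) (hd' i) hfin lam one_ne_zero (hg0 j)
  have hend : ∀ i lam j, ∃ s a, IsEdgeEnd π ((φ i).map ι) (g j) lam (-1) s a := fun i lam j =>
    exists_isEdgeEnd (hφ' i) (hd' i) hfin lam (neg_ne_zero.2 one_ne_zero) (hg0 j)
  choose s a hs using hstart
  choose t b ht using hend
  -- Additivity: the end points of the edge of `f` are the sums of those of the `g j`.
  have hsf : ∀ i lam, IsEdgeEnd π ((φ i).map ι) (f.map ι) lam 1 (∑ j, s i lam j)
      (∑ j, a i lam j) := fun i lam => by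
    rw [hfg]; exact IsLead.prod _ fun j _ => hs i lam j
  have htf : ∀ i lam, IsEdgeEnd π ((φ i).map ι) (f.map ι) lam (-1) (∑ j, t i lam j)
      (∑ j, b i lam j) := fun i lam => by
    rw [hfg]; exact IsLead.prod _ fun j _ => ht i lam j
  have hedge : ∀ j, ∃ lam, 0 < lam ∧ s (i j) lam j < t (i j) lam j := fun j => by
    obtain ⟨lam, hl, s', a', t', b', h1, h2, h3⟩ :=
      exists_edge (hφ' (i j)) (hd' (i j)) hπ0 hfin (hgC j) (hi j) (hgdvd _ _)
    refine ⟨lam, hl, ?_⟩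
    rwa [(hs _ lam j).unique (hφ' _) hπ0 hl h1, (ht _ lam j).unique (hφ' _) hπ0 hl h2]
  choose lam hlam hlt using hedge
  have hle : ∀ i l j, 0 < l → s i l j ≤ t i l j := fun i l j hl =>
    (hs i l j).le (hφ' i) hπ0 hl (ht i l j)
  have hside : ∀ j, (∑ k, s (i j) (lam j) k, ∑ k, t (i j) (lam j) k) ∈ negSides v (φ (i j)) f ∧
      slope (newtonPoint v (φ (i j)) f) (∑ k, s (i j) (lam j) k) (∑ k, t (i j) (lam j) k) =
        -lam j := fun j =>
    mem_negSides_of_isEdgeEnd hπ (hφ _) (hd _) (hlam j) (hsf _ _) (htf _ _)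
      (Finset.sum_lt_sum (fun k _ => hle _ _ k (hlam j)) ⟨j, Finset.mem_univ j, hlt j⟩)
  -- Each factor is sent to one index `i j` and the side of `f` that contains its edge; the fibres
  -- are then counted.
  let F : Fin N → (_ : Fin r) × (ℕ × ℕ) := fun j =>
    ⟨i j, (∑ k, s (i j) (lam j) k, ∑ k, t (i j) (lam j) k)⟩
  have hF : Set.MapsTo F (Finset.univ : Finset (Fin N))
      (Finset.univ.sigma fun i => negSides v (φ i) f : Finset ((_ : Fin r) × (ℕ × ℕ))) :=
    fun j _ => by simpa [F] using (hside j).1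
  have hcard := Finset.card_eq_sum_card_fiberwise hF
  rw [Finset.card_univ, Fintype.card_fin, Finset.sum_sigma] at hcard
  rw [hcard]
  refine Finset.sum_le_sum fun i₀ _ => Finset.sum_le_sum fun p _ => ?_
  rcases Finset.eq_empty_or_nonempty {j | F j = ⟨i₀, p⟩} with h | ⟨j₀, hj₀⟩
  · rw [h]; simp
  have hj₀ : F j₀ = ⟨i₀, p⟩ := by simpa using hj₀
  obtain ⟨rfl, hp⟩ := Sigma.mk.inj_iff.1 hj₀
  obtain rfl := eq_of_heq hp
  obtain ⟨-, hslope⟩ := hside j₀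
  have hden : (slope (newtonPoint v (φ (i j₀)) f) (∑ k, s (i j₀) (lam j₀) k)
      (∑ k, t (i j₀) (lam j₀) k)).den = (lam j₀).den := by rw [hslope, Rat.neg_den]
  have hlt₀ : ∑ k, s (i j₀) (lam j₀) k < ∑ k, t (i j₀) (lam j₀) k :=
    Finset.sum_lt_sum (fun k _ => hle _ _ k (hlam j₀)) ⟨j₀, Finset.mem_univ _, hlt j₀⟩
  have hdeg := sideDegree_mul_den (newtonPoint v (φ (i j₀)) f) hlt₀
  rw [hden] at hdeg
  -- After multiplication by `e`, the claim is that the fibre size times `e` is at most the length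
  -- of the side.
  refine Nat.le_of_mul_le_mul_right ?_ (lam j₀).den_pos
  dsimp only
  rw [hdeg, ← smul_eq_mul]
  have hsum : ∑ k, (t (i j₀) (lam j₀) k - s (i j₀) (lam j₀) k) =
      ∑ k, t (i j₀) (lam j₀) k - ∑ k, s (i j₀) (lam j₀) k :=
    Finset.sum_tsub_distrib _ fun k _ => hle _ _ k (hlam j₀)
  rw [← hsum]
  refine (Finset.card_nsmul_le_sum _ (fun k => t (i j₀) (lam j₀) k - s (i j₀) (lam j₀) k) _
    fun j hj => ?_).trans (Finset.sum_le_sum_of_subset (Finset.subset_univ _))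
  have hFj : F j = F j₀ := by simpa using hj
  obtain ⟨hij, hpj⟩ := Sigma.mk.inj_iff.1 hFj
  -- The side determines its slope, so all factors in the fibre share the same `lam`, and each
  -- contributes a positive multiple of `e`.
  have hlam_eq : lam j = lam j₀ := by
    have h1 := (hside j).2
    have h2 := Prod.mk.inj (eq_of_heq hpj)
    rw [h2.1, h2.2, hij, hslope] at h1
    exact (neg_injective h1).symm
  have h3 := hlt j
  rw [hij, hlam_eq] at h3
  exact Nat.le_of_dvd (Nat.sub_pos_of_lt h3)
    ((hs _ _ j).den_dvd (hφ' _) hπ0 (hlam j₀) (ht _ _ j))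

/-! ### From irreducible factors over the field to monic factors over its valuation ring -/

theorem associated_prod_map {M : Type*} [CommMonoid M] (S : Multiset M) {h : M → M}
    (hS : ∀ q ∈ S, Associated (h q) q) : Associated (S.map h).prod S.prod := by
  induction S using Multiset.induction_on with
  | empty => simp
  | cons q S ih =>
    rw [Multiset.map_cons, Multiset.prod_cons, Multiset.prod_cons]
    exact (hS q (by simp)).mul_mul (ih fun p hp => hS p (Multiset.mem_cons_of_mem hp))

-- Gauss's lemma: the valuation ring is integrally closed, so a factor of a monic polynomial becomes
-- integral once it is made monic.
open UniqueFactorizationMonoid in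
theorem exists_monic_lift_factors {f : w.valuationSubring[X]} (hf : f.Monic) :
    ∃ T : Multiset w.valuationSubring[X],
      Multiset.card T = Multiset.card (factors (f.map (algebraMap w.valuationSubring L))) ∧
      T.prod = f ∧ ∀ q ∈ T, q.Monic ∧ 0 < q.natDegree := by
  set κ := algebraMap w.valuationSubring L
  have hκ : Function.Injective κ := IsFractionRing.injective _ _
  have hf' := hf.map κ
  have key : ∀ q ∈ factors (f.map κ), ∃ q' : w.valuationSubring[X],
      (q'.Monic ∧ 0 < q'.natDegree) ∧ Associated (q'.map κ) q := by
    intro q hq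
    have hirr := irreducible_of_factor q hq
    obtain ⟨q', hq'⟩ := IsIntegrallyClosed.eq_map_mul_C_of_dvd L hf (dvd_of_mem_factors hq)
    have hlc : q.leadingCoeff ≠ 0 := leadingCoeff_ne_zero.2 hirr.ne_zero
    have hu : IsUnit (C q.leadingCoeff) := isUnit_C.2 hlc.isUnit
    have hmon : (q'.map κ).Monic := by
      have h := congrArg leadingCoeff hq'
      rw [leadingCoeff_mul, leadingCoeff_C] at h
      exact mul_right_cancel₀ hlc (h.trans (one_mul _).symm)
    have hassoc : Associated (q'.map κ) q := ⟨hu.unit, hq'⟩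
    refine ⟨q', ⟨monic_of_injective hκ hmon, ?_⟩, hassoc⟩
    rw [← natDegree_map_eq_of_injective hκ q']
    exact (hassoc.symm.irreducible hirr).natDegree_pos
  choose! l hl hl' using key
  refine ⟨(factors (f.map κ)).map l, Multiset.card_map _ _, ?_, ?_⟩
  · refine Polynomial.map_injective κ hκ (eq_of_monic_of_associated ?_ hf' ?_)
    · exact (monic_multiset_prod_of_monic _ _ fun q hq => (hl q hq).1).map κ
    · refine Associated.trans ?_ (factors_prod hf'.ne_zero)
      rw [Polynomial.map_multiset_prod, Multiset.map_map]
      exact associated_prod_map _ hl'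
  · intro q hq
    obtain ⟨q₀, h, rfl⟩ := Multiset.mem_map.1 hq
    exact hl q₀ h

open UniqueFactorizationMonoid in
/-- The bound on the number of irreducible factors over an immediate extension of `(K, v)`. -/
theorem card_factors_le_sum_sideDegree (hσ : ∀ x, w (σ x) = v x)
    (hres : ∀ x, w x ≤ 1 → ∃ y, w (x - σ y) < 1) (hv : Function.Surjective v)
    (f : v.valuationSubring[X]) (hf : f.Monic) (r : ℕ) (φ : Fin r → v.valuationSubring[X])
    (n : Fin r → ℕ) (hφ : ∀ i, (φ i).Monic) (hirr : ∀ i, Irreducible (reduction v (φ i)))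
    (hfac : reduction v f = ∏ i, reduction v (φ i) ^ n i) (hdvd : ∀ i, ¬ φ i ∣ f) :
    Multiset.card (factors ((f.map (algebraMap v.valuationSubring K)).map σ)) ≤
      ∑ i, ∑ p ∈ negSides v (φ i) f, sideDegree (newtonPoint v (φ i) f) p.1 p.2 := by
  have heq : (f.map (algebraMap v.valuationSubring K)).map σ =
      (f.map (valuationSubringMap v w σ hσ)).map (algebraMap w.valuationSubring L) := by
    rw [map_map, map_map]
    rfl
  obtain ⟨T, hT, hprod, hTm⟩ := exists_monic_lift_factors (w := w)
    (hf.map (valuationSubringMap v w σ hσ))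
  rw [heq, ← hT]
  induction T using Quotient.inductionOn with
  | h l =>
    refine card_le_sum_sideDegree hσ hres hv f r φ n hφ hirr hfac hdvd (N := l.length) l.get
      (fun j => (hTm _ (l.get_mem j)).1) (fun j => (hTm _ (l.get_mem j)).2) ?_
    rw [← hprod]
    simp [Fin.prod_univ_getElem]

end Count

/-! ### The henselization -/

theorem isOpen_lt_one (F : Type*) [Field F] [Valued F ℤᵐ⁰] :
    IsOpen {z : F | (Valued.v z : ℤᵐ⁰) < 1} := by
  simpa [Valuation.restrict_lt_one_iff] using Valued.isOpen_ball F 1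

section Henselization

variable {K : Type*} [Field K] (v : Valuation K ℤᵐ⁰)

/-- The valuation of the henselization, restricted from the completion. -/
noncomputable def henselizationValuation : Valuation (Henselization v) ℤᵐ⁰ :=
  (Valued.v : Valuation v.Completion ℤᵐ⁰).comap (algebraMap (Henselization v) v.Completion)

theorem henselizationValuation_toHenselization (x : K) :
    henselizationValuation v (toHenselization v x) = v x :=
  Valued.valuedCompletion_apply ((WithVal.equiv v).symm x)

/-- `K` is dense in the completion and the open unit ball around `x` is open, so the henselization
has the residue field of `K`. -/
theorem exists_henselizationValuation_sub_lt (x : Henselization v) :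
    ∃ y, henselizationValuation v (x - toHenselization v y) < 1 := by
  obtain ⟨y, hy⟩ := (UniformSpace.Completion.denseRange_coe (α := WithVal v)).exists_mem_open
    (s := {z | (Valued.v ((x : v.Completion) - z) : ℤᵐ⁰) < 1})
    ((isOpen_lt_one v.Completion).preimage (continuous_const.sub continuous_id)) ⟨x, by simp⟩
  exact ⟨WithVal.equiv v y, hy⟩

end Henselization

end NewtonFactor

open NewtonFactor UniqueFactorizationMonoid in
theorem mainTheorem2 {K : Type*} [Field K] (v : Valuation K ℤᵐ⁰) (hv : Function.Surjective v)
    (f : v.valuationSubring[X]) (hf : f.Monic)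
    (r : ℕ) (φ : Fin r → v.valuationSubring[X]) (n : Fin r → ℕ)
    (hφ : ∀ i, (φ i).Monic) (hirr : ∀ i, Irreducible (reduction v (φ i)))
    (hinj : Function.Injective fun i => reduction v (φ i)) (hn : ∀ i, 0 < n i)
    (hfac : reduction v f = ∏ i, reduction v (φ i) ^ n i)
    (hdvd : ∀ i, ¬ φ i ∣ f) :
    Multiset.card (factors
        ((f.map (algebraMap v.valuationSubring K)).map (toHenselization v))) ≤
      ∑ i, ∑ p ∈ negSides v (φ i) f, sideDegree (newtonPoint v (φ i) f) p.1 p.2 ∧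
    Multiset.card (factors (f.map (algebraMap v.valuationSubring K))) ≤
      ∑ i, ∑ p ∈ negSides v (φ i) f, sideDegree (newtonPoint v (φ i) f) p.1 p.2 := by
  refine ⟨card_factors_le_sum_sideDegree (henselizationValuation_toHenselization v)
    (fun x _ => exists_henselizationValuation_sub_lt v x) hv f hf r φ n hφ hirr hfac hdvd, ?_⟩
  -- `K` is an immediate extension of itself.
  have h := card_factors_le_sum_sideDegree (σ := RingHom.id K) (w := v) (fun _ => rfl)
    (fun x _ => ⟨x, by simp⟩) hv f hf r φ n hφ hirr hfac hdvd
  rwa [Polynomial.map_id] at h
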